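/- Let $d\ge 0$ and let $\alpha,\beta$ be Borel probability measures on $\mathbb{R}^d$ with finite second moments, $\int \|x\|^2\,d\alpha(x)<\infty$ and $\int\|y\|^2\,d\beta(y)<\infty$, and suppose that $\alpha$ has a density with respect to the Lebesgue measure. A transport map from $\alpha$ to $\beta$ is an ($\alpha$-almost everywhere defined) measurable map $T:\mathbb{R}^d\to\mathbb{R}^d$ with $T_\sharp\alpha=\beta$; it is an optimal Monge map if it minimizes $\int \|x-T(x)\|^2\,d\alpha(x)$ among all transport maps from $\alpha$ to $\beta$. We say that $T$ is the gradient of a convex function if there is a proper convex function $\varphi:\mathbb{R}^d\to\mathbb{R}\cup\{+\infty\}$ that, at $\alpha$-almost every $x$, is finite in a neighbourhood of $x$ and differentiable at $x$ with $\nabla\varphi(x)=T(x)$. Then there exists an optimal Monge map $T$ from $\alpha$ to $\beta$, and it is unique up to equality $\alpha$-almost everywhere. Moreover, $T$ is the gradient of a convex function $\varphi$, and it is, up to equality $\alpha$-almost everywhere, the only gradient of a convex function with $(\nabla\varphi)_\sharp\alpha=\beta$. In particular, a transport map from $\alpha$ to $\beta$ is an optimal Monge map if and only if it is the gradient of a convex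 function. -/

import Mathlib

open MeasureTheory Filter Topology
open scoped ENNReal

namespace Brenier

/-- `α` has a density with respect to the Lebesgue measure of `ℝ^d`. -/
def HasLebesgueDensity {d : ℕ} (α : Measure (EuclideanSpace ℝ (Fin d))) : Prop :=
  ∃ ρ : EuclideanSpace ℝ (Fin d) → ℝ≥0∞, Measurable ρ ∧ α = volume.withDensity ρ

/-- `T` is admissible for the Monge problem: `T_♯ α = β`. Maps are taken up to `α`-null sets,
so only almost-everywhere measurability is required. -/
def IsTransportMap {d : ℕ} (α β : Measure (EuclideanSpace ℝ (Fin d)))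
    (T : EuclideanSpace ℝ (Fin d) → EuclideanSpace ℝ (Fin d)) : Prop :=
  AEMeasurable T α ∧ α.map T = β

/-- The Monge cost `∫ ‖x - T x‖² dα(x)`, with values in `[0, ∞]`. -/
noncomputable def mongeCost {d : ℕ} (α : Measure (EuclideanSpace ℝ (Fin d)))
    (T : EuclideanSpace ℝ (Fin d) → EuclideanSpace ℝ (Fin d)) : ℝ≥0∞ :=
  ∫⁻ x, ‖x - T x‖ₑ ^ 2 ∂α

/-- `T` solves the Monge problem from `α` to `β` for the cost `‖x - y‖²`. -/
def IsOptimalMongeMap {d : ℕ} (α β : Measure (EuclideanSpace ℝ (Fin d)))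
    (T : EuclideanSpace ℝ (Fin d) → EuclideanSpace ℝ (Fin d)) : Prop :=
  IsTransportMap α β T ∧ ∀ S, IsTransportMap α β S → mongeCost α T ≤ mongeCost α S

/-- Proper convex functions `ℝ^d → ℝ ∪ {+∞}`: convexity is convexity of the epigraph. -/
structure IsProperConvex {d : ℕ} (φ : EuclideanSpace ℝ (Fin d) → EReal) : Prop where
  ne_bot : ∀ x, φ x ≠ ⊥
  exists_ne_top : ∃ x, φ x ≠ ⊤
  convex_epigraph : Convex ℝ {p : EuclideanSpace ℝ (Fin d) × ℝ | φ p.1 ≤ (p.2 : EReal)}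

/-- `φ` is finite near `x` and differentiable at `x` with gradient `g`. -/
def HasExtGradientAt {d : ℕ} (φ : EuclideanSpace ℝ (Fin d) → EReal)
    (g x : EuclideanSpace ℝ (Fin d)) : Prop :=
  (∀ᶠ z in 𝓝 x, φ z ≠ ⊥ ∧ φ z ≠ ⊤) ∧ HasGradientAt (fun z => (φ z).toReal) g x

/-- `T = ∇φ` holds `α`-almost everywhere for some convex `φ : ℝ^d → ℝ ∪ {+∞}`
(in particular `φ` is differentiable `α`-almost everywhere). -/
def IsGradientOfConvex {d : ℕ} (α : Measure (EuclideanSpace ℝ (Fin d)))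
    (T : EuclideanSpace ℝ (Fin d) → EuclideanSpace ℝ (Fin d)) : Prop :=
  ∃ φ : EuclideanSpace ℝ (Fin d) → EReal,
    IsProperConvex φ ∧ ∀ᵐ x ∂α, HasExtGradientAt φ (T x) x

end Brenier

/-!
Expanding the square, minimizing `∫ ‖x - y‖² dπ` over the couplings `π` of `α` and `β` amounts to
maximizing the correlation `∫ ⟪x, y⟫ dπ`. A maximizer exists because the set of couplings is weakly
compact, and its support is cyclically monotone: otherwise one could draw finitely many independent
samples of `π`, permute their first coordinates on the event that this increases the correlation,
and obtain a better coupling. By Rockafellar's theorem the support lies in the graph of the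
subdifferential of a convex function `f`, and `f` is differentiable Lebesgue-almost everywhere in
the interior of its domain, whose boundary is Lebesgue-null; since `α` does not charge null sets,
the coupling is concentrated on the graph of `∇f`.

Conversely, if `∇f` transports `α` to `β`, then integrating the Fenchel–Young inequality
`⟪x, y⟫ ≤ f x + f* y` against any coupling bounds its correlation by `∫ f dα + ∫ f* dβ`, which is
the correlation of `∇f`. Equality forces `y` to be a subgradient of `f` at `x` almost everywhere,
hence `y = ∇f x`; this gives both optimality and uniqueness.
-/

namespace Brenier

open scoped NNReal RealInnerProductSpace

section Coupling

variable {P X Y : Type*} [MeasurableSpace P] [MeasurableSpace X] [MeasurableSpace Y]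

/-- `π` is a coupling (transport plan) of `α` and `β`: its marginals are `α` and `β`. -/
structure IsCoupling (α : Measure X) (β : Measure Y) (π : Measure (X × Y)) : Prop where
  measurePreserving_fst : MeasurePreserving Prod.fst π α
  measurePreserving_snd : MeasurePreserving Prod.snd π β

theorem isCoupling_prod (α : Measure X) (β : Measure Y) [IsProbabilityMeasure α]
    [IsProbabilityMeasure β] : IsCoupling α β (α.prod β) :=
  ⟨measurePreserving_fst, measurePreserving_snd⟩

theorem isCoupling_map_prodMk {μ : Measure P} {f : P → X} {g : P → Y} (hf : AEMeasurable f μ)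
    (hg : AEMeasurable g μ) : IsCoupling (μ.map f) (μ.map g) (μ.map fun p => (f p, g p)) :=
  ⟨⟨measurable_fst, Measure.fst_map_prodMk₀ hg⟩, ⟨measurable_snd, Measure.snd_map_prodMk₀ hf⟩⟩

theorem IsCoupling.isProbabilityMeasure {α : Measure X} {β : Measure Y} {π : Measure (X × Y)}
    (h : IsCoupling α β π) [IsProbabilityMeasure α] : IsProbabilityMeasure π := by
  have : IsProbabilityMeasure (π.map Prod.fst) := by
    rwa [h.measurePreserving_fst.map_eq]
  exact Measure.isProbabilityMeasure_of_map Prod.fst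

theorem integral_comp_of_measurePreserving {F : Type*} [NormedAddCommGroup F] [NormedSpace ℝ F]
    {μ : Measure X} {ν : Measure Y} {g : X → Y} (hg : MeasurePreserving g μ ν) {f : Y → F}
    (hf : AEStronglyMeasurable f ν) : ∫ x, f (g x) ∂μ = ∫ y, f y ∂ν := by
  rw [← hg.map_eq] at hf ⊢
  exact (integral_map hg.aemeasurable hf).symm

end Coupling

section Existence

variable {X Y : Type*} [MeasurableSpace X] [TopologicalSpace X]
  [MeasurableSpace Y] [TopologicalSpace Y]

theorem continuous_lintegral_min_natCast [OpensMeasurableSpace X] {c : X → ℝ≥0}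
    (hc : Continuous c) (n : ℕ) :
    Continuous fun μ : ProbabilityMeasure X => ∫⁻ x, (min (c x) n : ℝ≥0) ∂(μ : Measure X) := by
  have hbound (x y : X) : dist (min (c x) n) (min (c y) n) ≤ n := by
    rw [NNReal.dist_eq]
    exact abs_sub_le_of_nonneg_of_le (NNReal.coe_nonneg _) (mod_cast min_le_right _ _)
      (NNReal.coe_nonneg _) (mod_cast min_le_right _ _)
  let f : BoundedContinuousFunction X ℝ≥0 :=
    BoundedContinuousFunction.mkOfBound ⟨fun x => min (c x) n, hc.min continuous_const⟩ n hbound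
  exact continuous_iff_continuousAt.2 fun _ =>
    ProbabilityMeasure.tendsto_iff_forall_lintegral_tendsto.1 tendsto_id f

theorem lowerSemicontinuous_lintegral [OpensMeasurableSpace X] {c : X → ℝ≥0} (hc : Continuous c) :
    LowerSemicontinuous fun μ : ProbabilityMeasure X => ∫⁻ x, c x ∂(μ : Measure X) := by
  have htrunc (x : X) : (c x : ℝ≥0∞) = ⨆ n : ℕ, ((min (c x) n : ℝ≥0) : ℝ≥0∞) := by
    obtain ⟨n, hn⟩ := exists_nat_ge (c x)
    refine le_antisymm (le_iSup_of_le n ?_) (iSup_le fun n => mod_cast min_le_left _ _)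
    rw [min_eq_left hn]
  have hsup (μ : ProbabilityMeasure X) : ∫⁻ x, c x ∂(μ : Measure X) =
      ⨆ n : ℕ, ∫⁻ x, (min (c x) n : ℝ≥0) ∂(μ : Measure X) := by
    simp_rw [htrunc]
    refine lintegral_iSup (fun n => (hc.min continuous_const).measurable.coe_nnreal_ennreal) ?_
    exact fun m n hmn x => ENNReal.coe_le_coe.2 (min_le_min_left _ (Nat.cast_le.2 hmn))
  simp_rw [hsup]
  exact lowerSemicontinuous_iSup fun n =>
    (continuous_lintegral_min_natCast hc n).lowerSemicontinuous

variable [PolishSpace X] [BorelSpace X] [PolishSpace Y] [BorelSpace Y]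
  (α : Measure X) (β : Measure Y) [IsProbabilityMeasure α] [IsProbabilityMeasure β]

theorem isClosed_setOf_isCoupling :
    IsClosed {π : ProbabilityMeasure (X × Y) | IsCoupling α β (π : Measure (X × Y))} := by
  have hmarginals : {π : ProbabilityMeasure (X × Y) | IsCoupling α β (π : Measure (X × Y))} =
      {π | π.map measurable_fst.aemeasurable = ⟨α, ‹_›⟩} ∩
        {π | π.map measurable_snd.aemeasurable = ⟨β, ‹_›⟩} := by
    ext π
    exact ⟨fun h => ⟨Subtype.ext h.1.map_eq, Subtype.ext h.2.map_eq⟩,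
      fun h => ⟨⟨measurable_fst, congrArg Subtype.val h.1⟩,
        ⟨measurable_snd, congrArg Subtype.val h.2⟩⟩⟩
  rw [hmarginals]
  exact (isClosed_singleton.preimage (ProbabilityMeasure.continuous_map continuous_fst)).inter
    (isClosed_singleton.preimage (ProbabilityMeasure.continuous_map continuous_snd))

theorem isCompact_setOf_isCoupling :
    IsCompact {π : ProbabilityMeasure (X × Y) | IsCoupling α β (π : Measure (X × Y))} := by
  rw [← (isClosed_setOf_isCoupling α β).closure_eq]
  refine isCompact_closure_of_isTightMeasureSet (IsTightMeasureSet.prodMk ?_ ?_)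
  · refine (isTightMeasureSet_singleton (μ := α)).subset ?_
    rintro _ ⟨_, ⟨π, hπ, rfl⟩, rfl⟩
    exact hπ.measurePreserving_fst.map_eq
  · refine (isTightMeasureSet_singleton (μ := β)).subset ?_
    rintro _ ⟨_, ⟨π, hπ, rfl⟩, rfl⟩
    exact hπ.measurePreserving_snd.map_eq

theorem exists_isCoupling_forall_lintegral_le {c : X × Y → ℝ≥0} (hc : Continuous c) :
    ∃ π, IsCoupling α β π ∧ ∀ π', IsCoupling α β π' → ∫⁻ p, c p ∂π ≤ ∫⁻ p, c p ∂π' := by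
  obtain ⟨π, hπ, hmin⟩ := LowerSemicontinuousOn.exists_isMinOn
    ⟨⟨α.prod β, inferInstance⟩, isCoupling_prod α β⟩ (isCompact_setOf_isCoupling α β)
    ((lowerSemicontinuous_lintegral hc).lowerSemicontinuousOn _)
  exact ⟨π, hπ, fun π' hπ' => hmin (a := ⟨π', hπ'.isProbabilityMeasure⟩) hπ'⟩

end Existence

section CyclicalMonotonicity

theorem measurePreserving_piecewise {P : Type*} [MeasurableSpace P] {μ : Measure P} {f g : P → P}
    {A : Set P} [DecidablePred (· ∈ A)] (hA : MeasurableSet A) (hf : MeasurePreserving f μ μ)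
    (hg : MeasurePreserving g μ μ) (hfA : f ⁻¹' A = A) (hgA : g ⁻¹' A = A) :
    MeasurePreserving (A.piecewise f g) μ μ := by
  refine ⟨hf.measurable.piecewise hA hg.measurable, Measure.ext fun B hB => ?_⟩
  have hpre : A.piecewise f g ⁻¹' B = f ⁻¹' (B ∩ A) ∪ g ⁻¹' (B \ A) := by
    rw [Set.piecewise_preimage, Set.ite, Set.preimage_inter, Set.preimage_sdiff, hfA, hgA]
  have hdisj : Disjoint (f ⁻¹' (B ∩ A)) (g ⁻¹' (B \ A)) := by
    rw [Set.preimage_inter, Set.preimage_sdiff, hfA, hgA]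
    exact Set.disjoint_sdiff_right.mono_left Set.inter_subset_right
  rw [Measure.map_apply (hf.measurable.piecewise hA hg.measurable) hB, hpre,
    measure_union hdisj (hg.measurable (hB.diff hA)),
    hf.measure_preimage (hB.inter hA).nullMeasurableSet,
    hg.measure_preimage (hB.diff hA).nullMeasurableSet, measure_inter_add_sdiff B hA]

variable {ι : Type*} [Fintype ι]

theorem measurePreserving_comp_perm {P : Type*} [MeasurableSpace P] (μ : Measure P) [SigmaFinite μ]
    (σ : Equiv.Perm ι) :
    MeasurePreserving (fun (w : ι → P) i => w (σ i)) (Measure.pi fun _ => μ)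
      (Measure.pi fun _ => μ) := by
  convert measurePreserving_piCongrLeft (fun _ : ι => μ) σ.symm using 1
  ext w i
  simp [MeasurableEquiv.coe_piCongrLeft, Equiv.piCongrLeft_apply]

theorem mem_support_pi {P : ι → Type*} [∀ i, MeasurableSpace (P i)] [∀ i, TopologicalSpace (P i)]
    {μ : ∀ i, Measure (P i)} [∀ i, SigmaFinite (μ i)] {z : ∀ i, P i}
    (hz : ∀ i, z i ∈ (μ i).support) : z ∈ (Measure.pi μ).support := by
  refine (Measure.mem_support_iff_forall z).2 fun U hU => ?_
  rw [nhds_pi, mem_pi'] at hU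
  obtain ⟨I, t, ht, htU⟩ := hU
  calc 0 < ∏ i, μ i (t i) := pos_iff_ne_zero.2 <| Finset.prod_ne_zero_iff.2 fun i _ =>
        ((Measure.mem_support_iff_forall _).1 (hz i) _ (ht i)).ne'
    _ = Measure.pi μ (Set.univ.pi t) := (Measure.pi_pi μ t).symm
    _ ≤ Measure.pi μ U := measure_mono fun w hw => htU fun i _ => hw i trivial

variable {X Y : Type*} [MeasurableSpace X] [MeasurableSpace Y] {α : Measure X} {β : Measure Y}
  {π : Measure (X × Y)} {c : X × Y → ℝ}

theorem IsCoupling.measurePreserving_exchange_fst [IsProbabilityMeasure π] (h : IsCoupling α β π)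
    {A : Set (ι → X × Y)} [DecidablePred (· ∈ A)] (hA : MeasurableSet A) {σ : Equiv.Perm ι}
    (hσA : (fun (w : ι → X × Y) i => w (σ i)) ⁻¹' A = A) (i : ι) :
    MeasurePreserving (fun w => (A.piecewise (fun w i => w (σ i)) id w i).1)
      (Measure.pi fun _ => π) α :=
  h.measurePreserving_fst.comp <| (measurePreserving_eval (fun _ => π) i).comp <|
    measurePreserving_piecewise hA (measurePreserving_comp_perm π σ) (.id _) hσA rfl

theorem integrable_comp_prodMk_of_measurePreserving {P : Type*} [MeasurableSpace P] {μ : Measure P}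
    {f : P → X} {g : P → Y} (hint : ∀ π', IsCoupling α β π' → Integrable c π')
    (hf : MeasurePreserving f μ α) (hg : MeasurePreserving g μ β) :
    Integrable (fun p => c (f p, g p)) μ := by
  have hcoupling := isCoupling_map_prodMk hf.aemeasurable hg.aemeasurable
  rw [hf.map_eq, hg.map_eq] at hcoupling
  exact (hint _ hcoupling).comp_measurable (hf.measurable.prodMk hg.measurable)

theorem integral_comp_prodMk_le_of_measurePreserving {P : Type*} [MeasurableSpace P] {μ : Measure P}
    {f : P → X} {g : P → Y} (hc : Measurable c)
    (hmax : ∀ π', IsCoupling α β π' → ∫ p, c p ∂π' ≤ ∫ p, c p ∂π)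
    (hf : MeasurePreserving f μ α) (hg : MeasurePreserving g μ β) :
    ∫ p, c (f p, g p) ∂μ ≤ ∫ p, c p ∂π := by
  have hcoupling := isCoupling_map_prodMk hf.aemeasurable hg.aemeasurable
  rw [hf.map_eq, hg.map_eq] at hcoupling
  rw [← integral_map (hf.measurable.prodMk hg.measurable).aemeasurable hc.aestronglyMeasurable]
  exact hmax _ hcoupling

theorem IsCoupling.integrable_comp_exchange [IsProbabilityMeasure π] (h : IsCoupling α β π)
    (hint : ∀ π', IsCoupling α β π' → Integrable c π') (i j : ι) :
    Integrable (fun w : ι → X × Y => c ((w j).1, (w i).2)) (Measure.pi fun _ => π) :=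
  integrable_comp_prodMk_of_measurePreserving hint
    (h.measurePreserving_fst.comp (measurePreserving_eval (fun _ => π) j))
    (h.measurePreserving_snd.comp (measurePreserving_eval (fun _ => π) i))

-- Exchanging the first coordinates only on a `σ`-invariant event yields another coupling.
theorem IsCoupling.setIntegral_exchange_le [IsProbabilityMeasure π] (h : IsCoupling α β π)
    (hc : Measurable c) (hint : ∀ π', IsCoupling α β π' → Integrable c π')
    (hmax : ∀ π', IsCoupling α β π' → ∫ p, c p ∂π' ≤ ∫ p, c p ∂π) {A : Set (ι → X × Y)}
    (hA : MeasurableSet A) {σ : Equiv.Perm ι} (hσA : (fun (w : ι → X × Y) i => w (σ i)) ⁻¹' A = A)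
    (i : ι) :
    ∫ w in A, c ((w (σ i)).1, (w i).2) ∂(Measure.pi fun _ => π) ≤
      ∫ w in A, c (w i) ∂(Measure.pi fun _ => π) := by
  classical
  let μ : Measure (ι → X × Y) := Measure.pi fun _ => π
  have heval := measurePreserving_eval fun _ : ι => π
  have hexch := h.integrable_comp_exchange hint i (σ i)
  have hself := h.integrable_comp_exchange hint i i
  have hsplit : ∫ w, c ((A.piecewise (fun w i => w (σ i)) id w i).1, (w i).2) ∂μ =
      ∫ w in A, c ((w (σ i)).1, (w i).2) ∂μ + ∫ w in Aᶜ, c (w i) ∂μ := by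
    rw [← integral_piecewise hA hexch.integrableOn hself.integrableOn]
    refine integral_congr_ae (ae_of_all _ fun w => ?_)
    by_cases hw : w ∈ A <;> simp [hw]
  have hle : ∫ w, c ((A.piecewise (fun w i => w (σ i)) id w i).1, (w i).2) ∂μ ≤
      ∫ w, c (w i) ∂μ := by
    rw [integral_comp_of_measurePreserving (heval i) hc.aestronglyMeasurable]
    exact integral_comp_prodMk_le_of_measurePreserving hc hmax
      (h.measurePreserving_exchange_fst hA hσA i) (h.measurePreserving_snd.comp (heval i))
  rw [hsplit, ← integral_add_compl hA hself] at hle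
  exact le_of_add_le_add_right hle

theorem IsCoupling.ae_sum_perm_le [IsProbabilityMeasure π] (h : IsCoupling α β π)
    (hc : Measurable c) (hint : ∀ π', IsCoupling α β π' → Integrable c π')
    (hmax : ∀ π', IsCoupling α β π' → ∫ p, c p ∂π' ≤ ∫ p, c p ∂π) (σ : Equiv.Perm ι) :
    ∀ᵐ w ∂Measure.pi fun _ : ι => π, ∑ i, c ((w (σ i)).1, (w i).2) ≤ ∑ i, c (w i) := by
  let μ : Measure (ι → X × Y) := Measure.pi fun _ => π
  let gain (w : ι → X × Y) : ℝ := ∑ i, (c ((w (σ i)).1, (w i).2) - c (w i))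
  let A : Set (ι → X × Y) := {w | 0 < gain w}
  have hA : MeasurableSet A := measurableSet_lt measurable_const (by fun_prop)
  have hσA : (fun (w : ι → X × Y) i => w (σ i)) ⁻¹' A = A := by
    ext w
    have hgain : gain (fun i => w (σ i)) = gain w :=
      Equiv.sum_comp σ fun i => c ((w (σ i)).1, (w i).2) - c (w i)
    simp only [A, Set.mem_preimage, Set.mem_ofPred_eq, hgain]
  have hterm (i : ι) : Integrable (fun w => c ((w (σ i)).1, (w i).2) - c (w i)) μ :=
    (h.integrable_comp_exchange hint i (σ i)).sub (h.integrable_comp_exchange hint i i)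
  have hgain_le : ∫ w in A, gain w ∂μ ≤ 0 := by
    rw [integral_finsetSum _ fun i _ => (hterm i).integrableOn]
    refine Finset.sum_nonpos fun i _ => ?_
    rw [integral_sub (h.integrable_comp_exchange hint i (σ i)).integrableOn
      (h.integrable_comp_exchange hint i i).integrableOn, sub_nonpos]
    exact h.setIntegral_exchange_le hc hint hmax hA hσA i
  have hnull : μ A = 0 := by
    by_contra hμA
    refine hgain_le.not_gt ((setIntegral_pos_iff_support_of_nonneg_ae
      (ae_restrict_of_forall_mem hA fun w hw => le_of_lt hw)
      (integrable_finsetSum _ fun i _ => hterm i).integrableOn).2 ?_)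
    have hsupp : A ⊆ Function.support gain := fun w hw => ne_of_gt hw
    rwa [Set.inter_eq_right.2 hsupp, pos_iff_ne_zero]
  simpa only [A, gain, Finset.sum_sub_distrib, sub_pos, ae_iff, not_le] using hnull

theorem IsCoupling.sum_perm_le_of_mem_support [TopologicalSpace X] [TopologicalSpace Y]
    [SecondCountableTopology X] [SecondCountableTopology Y] [OpensMeasurableSpace X]
    [OpensMeasurableSpace Y] [IsProbabilityMeasure π] (h : IsCoupling α β π) (hc : Continuous c)
    (hint : ∀ π', IsCoupling α β π' → Integrable c π')
    (hmax : ∀ π', IsCoupling α β π' → ∫ p, c p ∂π' ≤ ∫ p, c p ∂π) (σ : Equiv.Perm ι)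
    {z : ι → X × Y} (hz : ∀ i, z i ∈ π.support) :
    ∑ i, c ((z (σ i)).1, (z i).2) ≤ ∑ i, c (z i) := by
  have hclosed : IsClosed {w : ι → X × Y | ∑ i, c ((w (σ i)).1, (w i).2) ≤ ∑ i, c (w i)} :=
    isClosed_le (by fun_prop) (by fun_prop)
  exact Measure.support_subset_of_isClosed hclosed
    (h.ae_sum_perm_le hc.measurable hint hmax σ) (mem_support_pi hz)

end CyclicalMonotonicity

section Quadratic

variable {E : Type*} [NormedAddCommGroup E] [InnerProductSpace ℝ E]

theorem integrable_inner_of_integrable_sq_norm {P : Type*} [MeasurableSpace P] {μ : Measure P}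
    {f g : P → E} (hf : AEStronglyMeasurable f μ) (hg : AEStronglyMeasurable g μ)
    (hf2 : Integrable (fun p => ‖f p‖ ^ 2) μ) (hg2 : Integrable (fun p => ‖g p‖ ^ 2) μ) :
    Integrable (fun p => ⟪f p, g p⟫) μ := by
  refine (hf2.add hg2).mono' (hf.inner hg) (ae_of_all _ fun p => ?_)
  calc ‖⟪f p, g p⟫‖ ≤ ‖f p‖ * ‖g p‖ := norm_inner_le_norm _ _
    _ ≤ ‖f p‖ ^ 2 + ‖g p‖ ^ 2 := by nlinarith [sq_nonneg (‖f p‖ - ‖g p‖)]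

/-- `Γ` is cyclically monotone: for all `(x₀, y₀), …, (xₙ, yₙ)` in `Γ`,
`⟪y₀, x₁ - x₀⟫ + … + ⟪yₙ₋₁, xₙ - xₙ₋₁⟫ + ⟪yₙ, x₀ - xₙ⟫ ≤ 0`. The addition of `Fin (n + 1)` is
cyclic, which closes the cycle. -/
def IsCyclicallyMonotone (Γ : Set (E × E)) : Prop :=
  ∀ (n : ℕ) (z : Fin (n + 1) → E × E), (∀ i, z i ∈ Γ) →
    ∑ i, ⟪(z i).2, (z (i + 1)).1 - (z i).1⟫ ≤ 0

variable [SecondCountableTopology E] [MeasurableSpace E] [BorelSpace E] {α β : Measure E}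
  {π π' : Measure (E × E)}

theorem IsCoupling.integrable_inner (h : IsCoupling α β π)
    (hα2 : Integrable (fun x => ‖x‖ ^ 2) α) (hβ2 : Integrable (fun y => ‖y‖ ^ 2) β) :
    Integrable (fun p => ⟪p.1, p.2⟫) π :=
  integrable_inner_of_integrable_sq_norm measurable_fst.aestronglyMeasurable
    measurable_snd.aestronglyMeasurable (h.measurePreserving_fst.integrable_comp_of_integrable hα2)
    (h.measurePreserving_snd.integrable_comp_of_integrable hβ2)

theorem IsCoupling.integrable_sq_norm_sub (h : IsCoupling α β π)
    (hα2 : Integrable (fun x => ‖x‖ ^ 2) α) (hβ2 : Integrable (fun y => ‖y‖ ^ 2) β) :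
    Integrable (fun p => ‖p.1 - p.2‖ ^ 2) π := by
  simp_rw [norm_sub_sq_real]
  exact ((h.measurePreserving_fst.integrable_comp_of_integrable hα2).sub
    ((h.integrable_inner hα2 hβ2).const_mul 2)).add
    (h.measurePreserving_snd.integrable_comp_of_integrable hβ2)

theorem IsCoupling.integral_sq_norm_sub (h : IsCoupling α β π)
    (hα2 : Integrable (fun x => ‖x‖ ^ 2) α) (hβ2 : Integrable (fun y => ‖y‖ ^ 2) β) :
    ∫ p, ‖p.1 - p.2‖ ^ 2 ∂π =
      ∫ x, ‖x‖ ^ 2 ∂α - 2 * ∫ p, ⟪p.1, p.2⟫ ∂π + ∫ y, ‖y‖ ^ 2 ∂β := by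
  have hfst : Integrable (fun p : E × E => ‖p.1‖ ^ 2) π :=
    h.measurePreserving_fst.integrable_comp_of_integrable hα2
  have hsnd : Integrable (fun p : E × E => ‖p.2‖ ^ 2) π :=
    h.measurePreserving_snd.integrable_comp_of_integrable hβ2
  have hinner : Integrable (fun p : E × E => 2 * ⟪p.1, p.2⟫) π :=
    (h.integrable_inner hα2 hβ2).const_mul 2
  simp_rw [norm_sub_sq_real]
  rw [integral_add (by exact hfst.sub hinner) hsnd,
    integral_sub hfst hinner, integral_const_mul,
    integral_comp_of_measurePreserving h.measurePreserving_fst hα2.aestronglyMeasurable,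
    integral_comp_of_measurePreserving h.measurePreserving_snd hβ2.aestronglyMeasurable]

theorem IsCoupling.lintegral_enorm_sub_sq (h : IsCoupling α β π)
    (hα2 : Integrable (fun x => ‖x‖ ^ 2) α) (hβ2 : Integrable (fun y => ‖y‖ ^ 2) β) :
    ∫⁻ p, ‖p.1 - p.2‖ₑ ^ 2 ∂π = ENNReal.ofReal (∫ p, ‖p.1 - p.2‖ ^ 2 ∂π) := by
  rw [ofReal_integral_eq_lintegral_ofReal (h.integrable_sq_norm_sub hα2 hβ2)
    (ae_of_all _ fun p => sq_nonneg _)]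
  simp_rw [ENNReal.ofReal_pow (norm_nonneg _), ofReal_norm]

theorem IsCoupling.lintegral_enorm_sub_sq_le_iff (h : IsCoupling α β π) (h' : IsCoupling α β π')
    (hα2 : Integrable (fun x => ‖x‖ ^ 2) α) (hβ2 : Integrable (fun y => ‖y‖ ^ 2) β) :
    ∫⁻ p, ‖p.1 - p.2‖ₑ ^ 2 ∂π ≤ ∫⁻ p, ‖p.1 - p.2‖ₑ ^ 2 ∂π' ↔
      ∫ p, ⟪p.1, p.2⟫ ∂π' ≤ ∫ p, ⟪p.1, p.2⟫ ∂π := by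
  rw [h.lintegral_enorm_sub_sq hα2 hβ2, h'.lintegral_enorm_sub_sq hα2 hβ2,
    ENNReal.ofReal_le_ofReal_iff (integral_nonneg fun p => sq_nonneg _),
    h.integral_sq_norm_sub hα2 hβ2, h'.integral_sq_norm_sub hα2 hβ2]
  constructor <;> intro <;> linarith

theorem exists_isCoupling_forall_integral_inner_le [CompleteSpace E] [IsProbabilityMeasure α]
    [IsProbabilityMeasure β] (hα2 : Integrable (fun x => ‖x‖ ^ 2) α)
    (hβ2 : Integrable (fun y => ‖y‖ ^ 2) β) :
    ∃ π, IsCoupling α β π ∧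
      ∀ π', IsCoupling α β π' → ∫ p, ⟪p.1, p.2⟫ ∂π' ≤ ∫ p, ⟪p.1, p.2⟫ ∂π := by
  obtain ⟨π, hπ, hmin⟩ := exists_isCoupling_forall_lintegral_le α β
    (c := fun p : E × E => ‖p.1 - p.2‖₊ ^ 2) (by fun_prop)
  refine ⟨π, hπ, fun π' hπ' => (hπ.lintegral_enorm_sub_sq_le_iff hπ' hα2 hβ2).1 ?_⟩
  simpa only [enorm_eq_nnnorm, ENNReal.coe_pow] using hmin π' hπ'

theorem IsCoupling.isCyclicallyMonotone_support [IsProbabilityMeasure π] (h : IsCoupling α β π)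
    (hα2 : Integrable (fun x => ‖x‖ ^ 2) α) (hβ2 : Integrable (fun y => ‖y‖ ^ 2) β)
    (hmax : ∀ π', IsCoupling α β π' → ∫ p, ⟪p.1, p.2⟫ ∂π' ≤ ∫ p, ⟪p.1, p.2⟫ ∂π) :
    IsCyclicallyMonotone π.support := by
  intro n z hz
  have hswap := h.sum_perm_le_of_mem_support (c := fun p => ⟪p.1, p.2⟫) (by fun_prop)
    (fun π' hπ' => hπ'.integrable_inner hα2 hβ2) hmax (Equiv.addRight 1) hz
  simpa only [real_inner_comm, inner_sub_right, Finset.sum_sub_distrib, sub_nonpos,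
    Equiv.coe_addRight] using hswap

end Quadratic

section Rockafellar

variable {E : Type*} [NormedAddCommGroup E] [InnerProductSpace ℝ E] {f : E → ℝ} {s : Set E}
  {Γ : Set (E × E)}

/-- `y` is a subgradient at `x` of `f`, seen as a function with value `+∞` outside `s`. In
particular `x ∈ s`. -/
def IsSubgradientOn (f : E → ℝ) (s : Set E) (y x : E) : Prop :=
  x ∈ s ∧ ∀ z ∈ s, f x + ⟪y, z - x⟫ ≤ f z

theorem convexOn_ciSup {F ι : Type*} [AddCommGroup F] [Module ℝ F] [Nonempty ι] {A : ι → F → ℝ}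
    (hA : ∀ i, ConvexOn ℝ Set.univ (A i)) :
    ConvexOn ℝ {x | BddAbove (Set.range fun i => A i x)} fun x => ⨆ i, A i x := by
  have hle {x y : F} {a b : ℝ} (hx : BddAbove (Set.range fun i => A i x))
      (hy : BddAbove (Set.range fun i => A i y)) (ha : 0 ≤ a) (hb : 0 ≤ b) (hab : a + b = 1)
      (i : ι) : A i (a • x + b • y) ≤ a • (⨆ j, A j x) + b • ⨆ j, A j y :=
    ((hA i).2 trivial trivial ha hb hab).trans <| add_le_add
      (smul_le_smul_of_nonneg_left (le_ciSup hx i) ha)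
      (smul_le_smul_of_nonneg_left (le_ciSup hy i) hb)
  refine ⟨fun x hx y hy a b ha hb hab => ?_, fun x hx y hy a b ha hb hab => ?_⟩
  · exact ⟨_, Set.forall_mem_range.2 (hle hx hy ha hb hab)⟩
  · exact ciSup_le (hle hx hy ha hb hab)

/-- The affine function obtained by following the subgradients `(z i).2` along the points `(z i).1`
for `i ≤ n`, starting from the value `0` at `(z 0).1`. The potential in Rockafellar's theorem is a
supremum of such functions. -/
noncomputable def chainAffine (z : ℕ → E × E) (n : ℕ) (x : E) : ℝ :=
  ∑ i ∈ Finset.range n, ⟪(z i).2, (z (i + 1)).1 - (z i).1⟫ + ⟪(z n).2, x - (z n).1⟫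

theorem convexOn_chainAffine (z : ℕ → E × E) (n : ℕ) :
    ConvexOn ℝ Set.univ (chainAffine z n) := by
  refine ⟨convex_univ, fun x _ y _ a b _ _ hab => le_of_eq ?_⟩
  obtain rfl := eq_sub_of_add_eq hab
  simp only [chainAffine, inner_sub_right, inner_add_right, inner_smul_right, smul_eq_mul]
  ring

theorem IsCyclicallyMonotone.chainAffine_nonpos (hΓ : IsCyclicallyMonotone Γ) {z : ℕ → E × E}
    (hz : ∀ i, z i ∈ Γ) (n : ℕ) : chainAffine z n (z 0).1 ≤ 0 := by
  have hcycle := hΓ n (fun i => z i) fun i => hz i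
  rw [Fin.sum_univ_castSucc] at hcycle
  simp only [Fin.last_add_one, Fin.val_last, Fin.val_castSucc, Fin.coeSucc_eq_succ, Fin.val_succ,
    Fin.val_zero] at hcycle
  rwa [Fin.sum_univ_eq_sum_range fun i => ⟪(z i).2, (z (i + 1)).1 - (z i).1⟫] at hcycle

theorem chainAffine_append (z : ℕ → E × E) (n : ℕ) (p : E × E) (x : E) :
    chainAffine (fun i => if i ≤ n then z i else p) (n + 1) x =
      chainAffine z n p.1 + ⟪p.2, x - p.1⟫ := by
  have hinit : ∑ i ∈ Finset.range n, ⟪(if i ≤ n then z i else p).2,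
      (if i + 1 ≤ n then z (i + 1) else p).1 - (if i ≤ n then z i else p).1⟫ =
      ∑ i ∈ Finset.range n, ⟪(z i).2, (z (i + 1)).1 - (z i).1⟫ := by
    refine Finset.sum_congr rfl fun i hi => ?_
    have hin := Finset.mem_range.1 hi
    rw [if_pos hin.le, if_pos (Nat.succ_le_of_lt hin)]
  simp only [chainAffine, Finset.sum_range_succ, hinit, le_refl, if_true, Nat.not_succ_le_self,
    if_false]

theorem IsCyclicallyMonotone.exists_convexOn_isSubgradientOn (hΓ : IsCyclicallyMonotone Γ) :
    ∃ (s : Set E) (f : E → ℝ), ConvexOn ℝ s f ∧ ∀ p ∈ Γ, IsSubgradientOn f s p.2 p.1 := by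
  obtain rfl | ⟨p₀, hp₀⟩ := Γ.eq_empty_or_nonempty
  · exact ⟨Set.univ, 0, convexOn_const 0 convex_univ, fun _ => False.elim⟩
  let Chain := {z : ℕ → E × E // z 0 = p₀ ∧ ∀ i, z i ∈ Γ}
  let A (c : Chain × ℕ) (x : E) : ℝ := chainAffine c.1.1 c.2 x
  have : Nonempty Chain := ⟨⟨fun _ => p₀, rfl, fun _ => hp₀⟩⟩
  have happend {p : E × E} (hp : p ∈ Γ) (c : Chain × ℕ) :
      ∃ c', ∀ x, A c' x = A c p.1 + ⟪p.2, x - p.1⟫ :=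
    ⟨⟨⟨fun i => if i ≤ c.2 then c.1.1 i else p, by simpa using c.1.2.1, fun i => by
      dsimp only
      split_ifs
      exacts [c.1.2.2 i, hp]⟩, c.2 + 1⟩, chainAffine_append c.1.1 c.2 p⟩
  refine ⟨{x | BddAbove (Set.range fun c => A c x)}, fun x => ⨆ c, A c x,
    convexOn_ciSup fun c => convexOn_chainAffine c.1.1 c.2, fun p hp => ⟨?_, fun x hx => ?_⟩⟩
  · refine ⟨-⟪p.2, p₀.1 - p.1⟫, Set.forall_mem_range.2 fun c => ?_⟩
    obtain ⟨c', hc'⟩ := happend hp c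
    have hnonpos : A c' p₀.1 ≤ 0 := by
      simpa only [A, c'.1.2.1] using hΓ.chainAffine_nonpos c'.1.2.2 c'.2
    linarith [hc' p₀.1]
  · rw [← le_sub_iff_add_le]
    refine ciSup_le fun c => ?_
    obtain ⟨c', hc'⟩ := happend hp c
    rw [le_sub_iff_add_le, ← hc' x]
    exact le_ciSup hx c'

end Rockafellar

section Differentiability

variable {E : Type*} [NormedAddCommGroup E] {f : E → ℝ} {s : Set E} {g x y : E}

theorem isSubgradientOn_of_hasGradientAt [InnerProductSpace ℝ E] [CompleteSpace E]
    (hf : ConvexOn ℝ s f) (hx : x ∈ s) (hg : HasGradientAt f g x) : IsSubgradientOn f s g x := by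
  refine ⟨hx, fun z hz => ?_⟩
  let l : ℝ →ᵃ[ℝ] E := AffineMap.lineMap x z
  have hconv : ConvexOn ℝ (l ⁻¹' s) (f ∘ l) := hf.comp_affineMap l
  have hderiv : HasDerivAt (f ∘ l) ⟪g, z - x⟫ 0 := by
    have hfl : HasFDerivAt f (InnerProductSpace.toDual ℝ E g) (l 0) := by
      simpa only [l, AffineMap.lineMap_apply_zero] using hg.hasFDerivAt
    simpa only [InnerProductSpace.toDual_apply_apply] using
      hfl.comp_hasDerivAt 0 AffineMap.hasDerivAt_lineMap
  have hslope := hconv.le_slope_of_hasDerivAt (by simpa [l] using hx) (by simpa [l] using hz)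
    one_pos hderiv
  simp only [slope_def_field, Function.comp_apply, l, AffineMap.lineMap_apply_one,
    AffineMap.lineMap_apply_zero, sub_zero, div_one] at hslope
  exact le_sub_iff_add_le'.1 hslope

theorem IsSubgradientOn.eq_of_hasGradientAt [InnerProductSpace ℝ E] [CompleteSpace E]
    (hy : IsSubgradientOn f s y x) (hs : s ∈ 𝓝 x) (hg : HasGradientAt f g x) : y = g := by
  have hmin : IsLocalMin (fun z => f z - ⟪y, z⟫) x := by
    filter_upwards [hs] with z hz
    have hyz := hy.2 z hz
    rw [inner_sub_right] at hyz
    linarith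
  have hderiv : HasFDerivAt (fun z => f z - ⟪y, z⟫)
      (InnerProductSpace.toDual ℝ E g - InnerProductSpace.toDual ℝ E y) x :=
    hg.hasFDerivAt.sub (InnerProductSpace.toDual ℝ E y).hasFDerivAt
  exact ((InnerProductSpace.toDual ℝ E).injective
    (sub_eq_zero.1 (hmin.hasFDerivAt_eq_zero hderiv))).symm

variable [MeasurableSpace E] [BorelSpace E]

theorem ae_differentiableAt_of_convexOn [NormedSpace ℝ E] [FiniteDimensional ℝ E] {μ : Measure E}
    [μ.IsAddHaarMeasure] (hf : ConvexOn ℝ s f) :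
    ∀ᵐ x ∂μ, x ∈ interior s → DifferentiableAt ℝ f x := by
  rw [ae_iff]
  refine measure_null_of_locally_null _ fun x hx => ?_
  have hxs : x ∈ interior s := (Classical.not_imp.1 hx).1
  obtain ⟨K, t, ht, hK⟩ := hf.locallyLipschitzOn_interior hxs
  rw [isOpen_interior.nhdsWithin_eq hxs] at ht
  have hdiff := (hK.mono interior_subset).ae_differentiableWithinAt_of_mem (μ := μ)
  refine ⟨{y | ¬(y ∈ interior t → DifferentiableWithinAt ℝ f (interior t) y)}, ?_, ae_iff.1 hdiff⟩
  filter_upwards [self_mem_nhdsWithin, mem_nhdsWithin_of_mem_nhds (interior_mem_nhds.2 ht)]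
    with y hy hyt hdiffy
  exact hy fun _ => (hdiffy hyt).differentiableAt (isOpen_interior.mem_nhds hyt)

theorem measurable_gradient [InnerProductSpace ℝ E] [CompleteSpace E] (f : E → ℝ) :
    Measurable (gradient f) :=
  (InnerProductSpace.toDual ℝ E).symm.continuous.measurable.comp (measurable_fderiv ℝ f)

end Differentiability

section Conjugate

variable {E : Type*} [NormedAddCommGroup E] [InnerProductSpace ℝ E] {f : E → ℝ} {s : Set E}
  {x y : E}

/-- The Legendre–Fenchel conjugate of `f`, seen as a function with value `+∞` outside `s`. -/
noncomputable def conjugate (f : E → ℝ) (s : Set E) (y : E) : EReal :=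
  ⨆ x ∈ s, ((⟪x, y⟫ - f x : ℝ) : EReal)

theorem measurable_conjugate [MeasurableSpace E] [OpensMeasurableSpace E] (f : E → ℝ) (s : Set E) :
    Measurable (conjugate f s) :=
  LowerSemicontinuous.measurable <| lowerSemicontinuous_iSup fun x =>
    lowerSemicontinuous_iSup fun _ => Continuous.lowerSemicontinuous <|
      continuous_coe_real_ereal.comp (by fun_prop)

theorem inner_le_add_conjugate (hx : x ∈ s) (hy : conjugate f s y ≠ ⊤) :
    ⟪x, y⟫ ≤ f x + (conjugate f s y).toReal := by
  have hle : ((⟪x, y⟫ - f x : ℝ) : EReal) ≤ conjugate f s y := le_iSup₂_of_le x hx le_rfl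
  rw [← EReal.coe_toReal hy (ne_bot_of_le_ne_bot (EReal.coe_ne_bot _) hle),
    EReal.coe_le_coe_iff] at hle
  linarith

theorem IsSubgradientOn.conjugate_eq (h : IsSubgradientOn f s y x) :
    conjugate f s y = ((⟪x, y⟫ - f x : ℝ) : EReal) := by
  refine le_antisymm (iSup₂_le fun z hz => EReal.coe_le_coe_iff.2 ?_)
    (le_iSup₂_of_le x h.1 le_rfl)
  have hyz := h.2 z hz
  rw [inner_sub_right, real_inner_comm, real_inner_comm x] at hyz
  linarith

theorem isSubgradientOn_of_add_conjugate_le (hx : x ∈ s) (hy : conjugate f s y ≠ ⊤)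
    (hle : f x + (conjugate f s y).toReal ≤ ⟪x, y⟫) : IsSubgradientOn f s y x := by
  refine ⟨hx, fun z hz => ?_⟩
  have hyz := inner_le_add_conjugate hz hy
  rw [inner_sub_right, real_inner_comm, real_inner_comm x]
  linarith

/-- The gap in the Fenchel–Young inequality `⟪x, y⟫ ≤ f x + f* y` at `p = (x, y)`. It is only
meaningful where `x ∈ s` and `f*` is finite at `y`. -/
noncomputable def fenchelGap (f : E → ℝ) (s : Set E) (p : E × E) : ℝ :=
  f p.1 + (conjugate f s p.2).toReal - ⟪p.1, p.2⟫

variable [MeasurableSpace E] {α : Measure E} {S : E → E}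

theorem ae_conjugate_ne_top_of_ae_isSubgradientOn [OpensMeasurableSpace E] (hS : AEMeasurable S α)
    (hsub : ∀ᵐ x ∂α, IsSubgradientOn f s (S x) x) :
    ∀ᵐ y ∂α.map S, conjugate f s y ≠ ⊤ := by
  refine (ae_map_iff hS (measurable_conjugate f s (measurableSet_singleton ⊤)).compl).2 ?_
  filter_upwards [hsub] with x hx
  simp only [Set.mem_preimage, Set.mem_singleton_iff, hx.conjugate_eq, EReal.coe_ne_top,
    not_false_eq_true]

theorem IsCoupling.ae_mem_and_conjugate_ne_top [OpensMeasurableSpace E] {π : Measure (E × E)}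
    (h : IsCoupling α (α.map S) π) (hS : AEMeasurable S α)
    (hsub : ∀ᵐ x ∂α, IsSubgradientOn f s (S x) x) :
    ∀ᵐ p ∂π, p.1 ∈ s ∧ conjugate f s p.2 ≠ ⊤ := by
  filter_upwards [h.measurePreserving_fst.quasiMeasurePreserving.ae hsub,
    h.measurePreserving_snd.quasiMeasurePreserving.ae
      (ae_conjugate_ne_top_of_ae_isSubgradientOn hS hsub)] with p hp hpy
  exact ⟨hp.1, hpy⟩

theorem IsCoupling.fenchelGap_nonneg_ae [OpensMeasurableSpace E] {π : Measure (E × E)}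
    (h : IsCoupling α (α.map S) π) (hS : AEMeasurable S α)
    (hsub : ∀ᵐ x ∂α, IsSubgradientOn f s (S x) x) : 0 ≤ᵐ[π] fenchelGap f s :=
  (h.ae_mem_and_conjugate_ne_top hS hsub).mono fun _ hp =>
    sub_nonneg.2 (inner_le_add_conjugate hp.1 hp.2)

theorem toReal_conjugate_ae_eq_of_ae_isSubgradientOn
    (hsub : ∀ᵐ x ∂α, IsSubgradientOn f s (S x) x) :
    (fun x => (conjugate f s (S x)).toReal) =ᵐ[α] fun x => ⟪x, S x⟫ - f x :=
  hsub.mono fun x hx => by dsimp only; rw [hx.conjugate_eq, EReal.toReal_coe]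

end Conjugate

section Optimality

variable {E : Type*} [NormedAddCommGroup E] [InnerProductSpace ℝ E] [SecondCountableTopology E]
  [MeasurableSpace E] [BorelSpace E] {α : Measure E} {S : E → E} {f : E → ℝ} {s : Set E}

theorem aestronglyMeasurable_of_ae_isSubgradientOn (hS : AEMeasurable S α)
    (hsub : ∀ᵐ x ∂α, IsSubgradientOn f s (S x) x) : AEStronglyMeasurable f α := by
  have hconj : AEMeasurable (fun x => ⟪x, S x⟫ - (conjugate f s (S x)).toReal) α :=
    (aemeasurable_id.inner hS).sub ((measurable_conjugate f s).ereal_toReal.comp_aemeasurable hS)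
  refine hconj.aestronglyMeasurable.congr (hsub.mono fun x hx => ?_)
  dsimp only
  rw [hx.conjugate_eq, EReal.toReal_coe, sub_sub_cancel]

theorem integrable_of_ae_isSubgradientOn [IsFiniteMeasure α] (hS : AEMeasurable S α)
    (hα2 : Integrable (fun x => ‖x‖ ^ 2) α) (hS2 : Integrable (fun x => ‖S x‖ ^ 2) α)
    (hsub : ∀ᵐ x ∂α, IsSubgradientOn f s (S x) x) : Integrable f α := by
  obtain rfl | _ := eq_zero_or_neZero α
  · exact integrable_zero_measure
  obtain ⟨x₀, hx₀⟩ := hsub.exists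
  have hid : Integrable (fun x => x) α :=
    ((memLp_two_iff_integrable_sq_norm aestronglyMeasurable_id).2 hα2).integrable one_le_two
  have hSint : Integrable S α :=
    ((memLp_two_iff_integrable_sq_norm hS.aestronglyMeasurable).2 hS2).integrable one_le_two
  have hlower : Integrable (fun x => f x₀ + ⟪S x₀, x - x₀⟫) α :=
    (integrable_const _).add ((hid.sub (integrable_const _)).const_inner _)
  have hupper : Integrable (fun x => f x₀ - ⟪S x, x₀ - x⟫) α := by
    simp_rw [inner_sub_right]
    exact (integrable_const _).sub ((hSint.inner_const _).sub
      (integrable_inner_of_integrable_sq_norm hS.aestronglyMeasurable aestronglyMeasurable_id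
        hS2 hα2))
  refine integrable_of_le_of_le (aestronglyMeasurable_of_ae_isSubgradientOn hS hsub)
    (hsub.mono fun x hx => hx₀.2 x hx.1) (hsub.mono fun x hx => ?_) hlower hupper
  exact le_sub_iff_add_le.2 (hx.2 x₀ hx₀.1)

theorem integrable_conjugate_of_ae_isSubgradientOn [IsFiniteMeasure α] (hS : AEMeasurable S α)
    (hα2 : Integrable (fun x => ‖x‖ ^ 2) α) (hS2 : Integrable (fun x => ‖S x‖ ^ 2) α)
    (hsub : ∀ᵐ x ∂α, IsSubgradientOn f s (S x) x) :
    Integrable (fun y => (conjugate f s y).toReal) (α.map S) := by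
  refine (integrable_map_measure
    (measurable_conjugate f s).ereal_toReal.aestronglyMeasurable hS).2 ?_
  refine ((integrable_inner_of_integrable_sq_norm aestronglyMeasurable_id hS.aestronglyMeasurable
    hα2 hS2).sub (integrable_of_ae_isSubgradientOn hS hα2 hS2 hsub)).congr ?_
  exact (toReal_conjugate_ae_eq_of_ae_isSubgradientOn hsub).symm

theorem integral_add_integral_conjugate_eq [IsFiniteMeasure α] (hS : AEMeasurable S α)
    (hα2 : Integrable (fun x => ‖x‖ ^ 2) α) (hS2 : Integrable (fun x => ‖S x‖ ^ 2) α)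
    (hsub : ∀ᵐ x ∂α, IsSubgradientOn f s (S x) x) :
    ∫ x, f x ∂α + ∫ y, (conjugate f s y).toReal ∂(α.map S) = ∫ x, ⟪x, S x⟫ ∂α := by
  have hinner : Integrable (fun x => ⟪x, S x⟫) α :=
    integrable_inner_of_integrable_sq_norm aestronglyMeasurable_id hS.aestronglyMeasurable hα2 hS2
  rw [integral_map hS (measurable_conjugate f s).ereal_toReal.aestronglyMeasurable,
    integral_congr_ae (toReal_conjugate_ae_eq_of_ae_isSubgradientOn hsub),
    integral_sub hinner (integrable_of_ae_isSubgradientOn hS hα2 hS2 hsub), add_sub_cancel]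

variable {π : Measure (E × E)}

theorem IsCoupling.integrable_fenchelGap [IsFiniteMeasure α] (h : IsCoupling α (α.map S) π)
    (hS : AEMeasurable S α) (hα2 : Integrable (fun x => ‖x‖ ^ 2) α)
    (hS2 : Integrable (fun x => ‖S x‖ ^ 2) α) (hsub : ∀ᵐ x ∂α, IsSubgradientOn f s (S x) x) :
    Integrable (fenchelGap f s) π :=
  ((h.measurePreserving_fst.integrable_comp_of_integrable
    (integrable_of_ae_isSubgradientOn hS hα2 hS2 hsub)).add
    (h.measurePreserving_snd.integrable_comp_of_integrable
      (integrable_conjugate_of_ae_isSubgradientOn hS hα2 hS2 hsub))).sub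
    (h.integrable_inner hα2 ((integrable_map_measure (by fun_prop) hS).2 hS2))

theorem IsCoupling.integral_fenchelGap [IsFiniteMeasure α] (h : IsCoupling α (α.map S) π)
    (hS : AEMeasurable S α) (hα2 : Integrable (fun x => ‖x‖ ^ 2) α)
    (hS2 : Integrable (fun x => ‖S x‖ ^ 2) α) (hsub : ∀ᵐ x ∂α, IsSubgradientOn f s (S x) x) :
    ∫ p, fenchelGap f s p ∂π = ∫ x, ⟪x, S x⟫ ∂α - ∫ p, ⟪p.1, p.2⟫ ∂π := by
  have hf := integrable_of_ae_isSubgradientOn hS hα2 hS2 hsub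
  have hconj := integrable_conjugate_of_ae_isSubgradientOn hS hα2 hS2 hsub
  have hfst : Integrable (fun p : E × E => f p.1) π :=
    h.measurePreserving_fst.integrable_comp_of_integrable hf
  have hsnd : Integrable (fun p : E × E => (conjugate f s p.2).toReal) π :=
    h.measurePreserving_snd.integrable_comp_of_integrable hconj
  have hinner : Integrable (fun p : E × E => ⟪p.1, p.2⟫) π :=
    h.integrable_inner hα2 ((integrable_map_measure (by fun_prop) hS).2 hS2)
  simp only [fenchelGap]
  rw [integral_sub (by exact hfst.add hsnd) hinner, integral_add hfst hsnd,
    integral_comp_of_measurePreserving h.measurePreserving_fst hf.aestronglyMeasurable,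
    integral_comp_of_measurePreserving h.measurePreserving_snd hconj.aestronglyMeasurable,
    integral_add_integral_conjugate_eq hS hα2 hS2 hsub]

theorem IsCoupling.integral_inner_le_of_ae_isSubgradientOn [IsFiniteMeasure α]
    (h : IsCoupling α (α.map S) π) (hS : AEMeasurable S α)
    (hα2 : Integrable (fun x => ‖x‖ ^ 2) α) (hS2 : Integrable (fun x => ‖S x‖ ^ 2) α)
    (hsub : ∀ᵐ x ∂α, IsSubgradientOn f s (S x) x) :
    ∫ p, ⟪p.1, p.2⟫ ∂π ≤ ∫ x, ⟪x, S x⟫ ∂α := by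
  rw [← sub_nonneg, ← h.integral_fenchelGap hS hα2 hS2 hsub]
  exact integral_nonneg_of_ae (h.fenchelGap_nonneg_ae hS hsub)

theorem IsCoupling.ae_isSubgradientOn_of_le_integral_inner [IsFiniteMeasure α]
    (h : IsCoupling α (α.map S) π) (hS : AEMeasurable S α)
    (hα2 : Integrable (fun x => ‖x‖ ^ 2) α) (hS2 : Integrable (fun x => ‖S x‖ ^ 2) α)
    (hsub : ∀ᵐ x ∂α, IsSubgradientOn f s (S x) x)
    (hle : ∫ x, ⟪x, S x⟫ ∂α ≤ ∫ p, ⟪p.1, p.2⟫ ∂π) :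
    ∀ᵐ p ∂π, IsSubgradientOn f s p.2 p.1 := by
  have hnonneg := h.fenchelGap_nonneg_ae hS hsub
  have hintegral : ∫ p, fenchelGap f s p ∂π = 0 :=
    le_antisymm ((h.integral_fenchelGap hS hα2 hS2 hsub).trans_le (sub_nonpos.2 hle))
      (integral_nonneg_of_ae hnonneg)
  have hgap : fenchelGap f s =ᵐ[π] 0 :=
    (integral_eq_zero_iff_of_nonneg_ae hnonneg (h.integrable_fenchelGap hS hα2 hS2 hsub)).1
      hintegral
  filter_upwards [hgap, h.ae_mem_and_conjugate_ne_top hS hsub] with p hp hps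
  exact isSubgradientOn_of_add_conjugate_le hps.1 hps.2 (sub_eq_zero.1 hp).le

end Optimality

section Monge

/-- `T` transports `α` to `β`: this is `IsTransportMap` on arbitrary measurable spaces. -/
def IsTransport {X Y : Type*} [MeasurableSpace X] [MeasurableSpace Y] (α : Measure X)
    (β : Measure Y) (T : X → Y) : Prop :=
  AEMeasurable T α ∧ α.map T = β

theorem IsTransport.isCoupling_graph {X Y : Type*} [MeasurableSpace X] [MeasurableSpace Y]
    {α : Measure X} {β : Measure Y} {T : X → Y} (hT : IsTransport α β T) :
    IsCoupling α β (α.map fun x => (x, T x)) := by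
  simpa only [Measure.map_id', hT.2] using isCoupling_map_prodMk aemeasurable_id' hT.1

variable {E : Type*} [NormedAddCommGroup E] [MeasurableSpace E]

/-- `T` solves the Monge problem from `α` to `β` for the cost `‖x - y‖²`: this is
`IsOptimalMongeMap` on a normed group. -/
def IsOptimalTransport (α β : Measure E) (T : E → E) : Prop :=
  IsTransport α β T ∧ ∀ S, IsTransport α β S →
    ∫⁻ x, ‖x - T x‖ₑ ^ 2 ∂α ≤ ∫⁻ x, ‖x - S x‖ₑ ^ 2 ∂α

variable {α β : Measure E} {S T : E → E}

theorem lintegral_enorm_sub_sq_map_graph [BorelSpace E] [SecondCountableTopology E]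
    (hT : AEMeasurable T α) :
    ∫⁻ p, ‖p.1 - p.2‖ₑ ^ 2 ∂(α.map fun x => (x, T x)) = ∫⁻ x, ‖x - T x‖ₑ ^ 2 ∂α :=
  lintegral_map' (by fun_prop) (aemeasurable_id.prodMk hT)

theorem IsTransport.integrable_sq_norm (hT : IsTransport α β T)
    (hβ2 : Integrable (fun y => ‖y‖ ^ 2) β) : Integrable (fun x => ‖T x‖ ^ 2) α := by
  obtain ⟨hTm, rfl⟩ := hT
  exact hβ2.comp_aemeasurable hTm

variable [InnerProductSpace ℝ E]

/-- `T = ∇f` holds `α`-almost everywhere for some real function `f` convex on a set `s` which is a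
neighbourhood of `α`-almost every point. Compared with `IsGradientOfConvex`, the extended-real
potential is encoded by its domain `s` and its values `f` there. -/
def IsConvexGradient [CompleteSpace E] (α : Measure E) (T : E → E) : Prop :=
  ∃ (s : Set E) (f : E → ℝ), ConvexOn ℝ s f ∧ ∀ᵐ x ∂α, s ∈ 𝓝 x ∧ HasGradientAt f (T x) x

theorem IsConvexGradient.congr_ae [CompleteSpace E] (hT : IsConvexGradient α T) (h : S =ᵐ[α] T) :
    IsConvexGradient α S := by
  obtain ⟨s, f, hf, hg⟩ := hT
  refine ⟨s, f, hf, ?_⟩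
  filter_upwards [hg, h] with x hx hxS
  rwa [hxS]

variable [BorelSpace E] [SecondCountableTopology E]

theorem integral_inner_map_graph (hT : AEMeasurable T α) :
    ∫ p, ⟪p.1, p.2⟫ ∂(α.map fun x => (x, T x)) = ∫ x, ⟪x, T x⟫ ∂α :=
  integral_map (aemeasurable_id.prodMk hT) (by fun_prop)

theorem IsTransport.lintegral_enorm_sub_sq_le_iff (hS : IsTransport α β S) (hT : IsTransport α β T)
    (hα2 : Integrable (fun x => ‖x‖ ^ 2) α) (hβ2 : Integrable (fun y => ‖y‖ ^ 2) β) :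
    ∫⁻ x, ‖x - S x‖ₑ ^ 2 ∂α ≤ ∫⁻ x, ‖x - T x‖ₑ ^ 2 ∂α ↔
      ∫ x, ⟪x, T x⟫ ∂α ≤ ∫ x, ⟪x, S x⟫ ∂α := by
  rw [← lintegral_enorm_sub_sq_map_graph hS.1, ← lintegral_enorm_sub_sq_map_graph hT.1,
    ← integral_inner_map_graph hS.1, ← integral_inner_map_graph hT.1]
  exact hS.isCoupling_graph.lintegral_enorm_sub_sq_le_iff hT.isCoupling_graph hα2 hβ2

variable [CompleteSpace E] [IsFiniteMeasure α]

theorem IsConvexGradient.isOptimalTransport (hgrad : IsConvexGradient α T)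
    (hT : IsTransport α β T) (hα2 : Integrable (fun x => ‖x‖ ^ 2) α)
    (hβ2 : Integrable (fun y => ‖y‖ ^ 2) β) : IsOptimalTransport α β T := by
  obtain ⟨s, f, hf, hg⟩ := hgrad
  have hsub : ∀ᵐ x ∂α, IsSubgradientOn f s (T x) x := hg.mono fun x hx =>
    isSubgradientOn_of_hasGradientAt hf (mem_of_mem_nhds hx.1) hx.2
  refine ⟨hT, fun S hS => (hT.lintegral_enorm_sub_sq_le_iff hS hα2 hβ2).2 ?_⟩
  have hgraph : IsCoupling α (α.map T) (α.map fun x => (x, S x)) :=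
    hT.2.symm ▸ hS.isCoupling_graph
  rw [← integral_inner_map_graph hS.1]
  exact hgraph.integral_inner_le_of_ae_isSubgradientOn hT.1 hα2 (hT.integrable_sq_norm hβ2) hsub

theorem IsConvexGradient.ae_eq_of_isOptimalTransport (hgrad : IsConvexGradient α T)
    (hT : IsTransport α β T) (hS : IsOptimalTransport α β S)
    (hα2 : Integrable (fun x => ‖x‖ ^ 2) α) (hβ2 : Integrable (fun y => ‖y‖ ^ 2) β) :
    S =ᵐ[α] T := by
  obtain ⟨s, f, hf, hg⟩ := hgrad
  have hsub : ∀ᵐ x ∂α, IsSubgradientOn f s (T x) x := hg.mono fun x hx =>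
    isSubgradientOn_of_hasGradientAt hf (mem_of_mem_nhds hx.1) hx.2
  have hgraph : IsCoupling α (α.map T) (α.map fun x => (x, S x)) :=
    hT.2.symm ▸ hS.1.isCoupling_graph
  have hle : ∫ x, ⟪x, T x⟫ ∂α ≤ ∫ p, ⟪p.1, p.2⟫ ∂(α.map fun x => (x, S x)) := by
    rw [integral_inner_map_graph hS.1.1]
    exact (hS.1.lintegral_enorm_sub_sq_le_iff hT hα2 hβ2).1 (hS.2 T hT)
  have hsubS : ∀ᵐ x ∂α, IsSubgradientOn f s (S x) x :=
    ae_of_ae_map (aemeasurable_id.prodMk hS.1.1) <|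
      hgraph.ae_isSubgradientOn_of_le_integral_inner hT.1 hα2 (hT.integrable_sq_norm hβ2) hsub hle
  filter_upwards [hsubS, hg] with x hx hgx
  exact hx.eq_of_hasGradientAt hgx.1 hgx.2

end Monge

section BrenierMap

variable {E : Type*} [NormedAddCommGroup E] [MeasurableSpace E] [BorelSpace E] {α β : Measure E}

theorem IsCoupling.isTransport_of_ae_eq {X Y : Type*} [MeasurableSpace X] [MeasurableSpace Y]
    {α : Measure X} {β : Measure Y} {π : Measure (X × Y)} {T : X → Y} (h : IsCoupling α β π)
    (hT : Measurable T) (heq : ∀ᵐ p ∂π, p.2 = T p.1) : IsTransport α β T := by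
  refine ⟨hT.aemeasurable, ?_⟩
  calc α.map T = (π.map Prod.fst).map T := by rw [h.measurePreserving_fst.map_eq]
    _ = π.map (T ∘ Prod.fst) := Measure.map_map hT measurable_fst
    _ = π.map Prod.snd := Measure.map_congr (heq.mono fun _ hp => hp.symm)
    _ = β := h.measurePreserving_snd.map_eq

theorem ae_mem_interior_of_convex [NormedSpace ℝ E] [FiniteDimensional ℝ E] {μ : Measure E}
    [μ.IsAddHaarMeasure] {s : Set E} (hs : Convex ℝ s) : ∀ᵐ x ∂μ, x ∈ s → x ∈ interior s := by
  filter_upwards [measure_eq_zero_iff_ae_notMem.1 (hs.addHaar_frontier μ)] with x hx hxs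
  by_contra hxi
  exact hx ⟨subset_closure hxs, hxi⟩

variable [InnerProductSpace ℝ E] [FiniteDimensional ℝ E]

theorem exists_isTransport_isConvexGradient [IsProbabilityMeasure α] [IsProbabilityMeasure β]
    {μ : Measure E} [μ.IsAddHaarMeasure] (hα2 : Integrable (fun x => ‖x‖ ^ 2) α)
    (hβ2 : Integrable (fun y => ‖y‖ ^ 2) β) (hα : α ≪ μ) :
    ∃ T, Measurable T ∧ IsTransport α β T ∧ IsConvexGradient α T := by
  obtain ⟨π, hπ, hmax⟩ := exists_isCoupling_forall_integral_inner_le hα2 hβ2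
  have := hπ.isProbabilityMeasure
  obtain ⟨s, f, hf, hsub⟩ :=
    (hπ.isCyclicallyMonotone_support hα2 hβ2 hmax).exists_convexOn_isSubgradientOn
  have hinterior : ∀ᵐ x ∂α, x ∈ interior s := by
    rw [← hπ.measurePreserving_fst.map_eq]
    refine (ae_map_iff measurable_fst.aemeasurable isOpen_interior.measurableSet).2 ?_
    filter_upwards [Measure.support_mem_ae, hπ.measurePreserving_fst.quasiMeasurePreserving.ae
      (hα.ae_le (ae_mem_interior_of_convex hf.1))] with p hp hint
    exact hint (hsub p hp).1
  have hgrad : ∀ᵐ x ∂α, s ∈ 𝓝 x ∧ HasGradientAt f (gradient f x) x := by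
    filter_upwards [hinterior, hα.ae_le (ae_differentiableAt_of_convexOn hf)] with x hx hdiff
    exact ⟨mem_interior_iff_mem_nhds.1 hx, (hdiff hx).hasGradientAt⟩
  have hgraph : ∀ᵐ p ∂π, p.2 = gradient f p.1 := by
    filter_upwards [Measure.support_mem_ae,
      hπ.measurePreserving_fst.quasiMeasurePreserving.ae hgrad] with p hp hgp
    exact (hsub p hp).eq_of_hasGradientAt hgp.1 hgp.2
  exact ⟨gradient f, measurable_gradient f,
    hπ.isTransport_of_ae_eq (measurable_gradient f) hgraph, s, f, hf, hgrad⟩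

end BrenierMap

section EuclideanSpace

variable {d : ℕ} {α : Measure (EuclideanSpace ℝ (Fin d))}
  {T : EuclideanSpace ℝ (Fin d) → EuclideanSpace ℝ (Fin d)}

theorem HasLebesgueDensity.absolutelyContinuous (hα : HasLebesgueDensity α) : α ≪ volume := by
  obtain ⟨ρ, -, rfl⟩ := hα
  exact withDensity_absolutelyContinuous _ _

theorem IsProperConvex.convexOn_toReal {φ : EuclideanSpace ℝ (Fin d) → EReal}
    (hφ : IsProperConvex φ) : ConvexOn ℝ {x | φ x ≠ ⊤} fun x => (φ x).toReal := by
  refine convexOn_iff_convex_epigraph.2 ?_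
  convert hφ.convex_epigraph using 1
  ext ⟨x, r⟩
  refine ⟨fun ⟨hx, hr⟩ => ?_, fun hr => ?_⟩
  · change φ x ≤ r
    rwa [← EReal.coe_toReal hx (hφ.ne_bot x), EReal.coe_le_coe_iff]
  · have hx : φ x ≠ ⊤ := ne_top_of_le_ne_top (EReal.coe_ne_top r) hr
    exact ⟨hx, EReal.coe_le_coe_iff.1 ((EReal.coe_toReal hx (hφ.ne_bot x)).trans_le hr)⟩

/-- The extended-real function with values `f` on `s` and `+∞` outside `s`. -/
noncomputable def extendTop {X : Type*} (f : X → ℝ) (s : Set X) (x : X) : EReal :=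
  ⨅ _ : x ∈ s, (f x : EReal)

theorem extendTop_le_coe_iff {X : Type*} {f : X → ℝ} {s : Set X} {x : X} {r : ℝ} :
    extendTop f s x ≤ r ↔ x ∈ s ∧ f x ≤ r := by
  by_cases hx : x ∈ s <;> simp [extendTop, hx]

theorem extendTop_of_mem {X : Type*} {f : X → ℝ} {s : Set X} {x : X} (hx : x ∈ s) :
    extendTop f s x = f x :=
  iInf_pos hx

theorem isProperConvex_extendTop {s : Set (EuclideanSpace ℝ (Fin d))}
    {f : EuclideanSpace ℝ (Fin d) → ℝ} (hf : ConvexOn ℝ s f) (hs : s.Nonempty) :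
    IsProperConvex (extendTop f s) where
  ne_bot x := by
    by_cases hx : x ∈ s <;> simp [extendTop, hx]
  exists_ne_top := by
    obtain ⟨x, hx⟩ := hs
    exact ⟨x, extendTop_of_mem hx ▸ EReal.coe_ne_top _⟩
  convex_epigraph := by
    simpa only [extendTop_le_coe_iff] using hf.convex_epigraph

theorem isGradientOfConvex_iff_isConvexGradient [NeZero α] :
    IsGradientOfConvex α T ↔ IsConvexGradient α T := by
  constructor
  · rintro ⟨φ, hφ, hgrad⟩
    refine ⟨{x | φ x ≠ ⊤}, fun x => (φ x).toReal, hφ.convexOn_toReal, ?_⟩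
    exact hgrad.mono fun x hx => ⟨hx.1.mono fun _ hz => hz.2, hx.2⟩
  · rintro ⟨s, f, hf, hgrad⟩
    obtain ⟨x₀, hx₀, -⟩ := hgrad.exists
    refine ⟨extendTop f s, isProperConvex_extendTop hf ⟨x₀, mem_of_mem_nhds hx₀⟩, ?_⟩
    filter_upwards [hgrad] with x ⟨hs, hg⟩
    have heq : ∀ᶠ z in 𝓝 x, extendTop f s z = f z := by
      filter_upwards [hs] with z hz using extendTop_of_mem hz
    refine ⟨heq.mono fun z hz => hz ▸ ⟨EReal.coe_ne_bot _, EReal.coe_ne_top _⟩,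
      hg.congr_of_eventuallyEq (heq.mono fun z hz => ?_)⟩
    simp only [hz, EReal.toReal_coe]

end EuclideanSpace

end Brenier

theorem mainTheorem1_general {E : Type*} [NormedAddCommGroup E] [InnerProductSpace ℝ E]
    [FiniteDimensional ℝ E] [MeasurableSpace E] [BorelSpace E] {α β : Measure E}
    [IsProbabilityMeasure α] [IsProbabilityMeasure β] {μ : Measure E} [μ.IsAddHaarMeasure]
    (hα2 : Integrable (fun x => ‖x‖ ^ 2) α) (hβ2 : Integrable (fun y => ‖y‖ ^ 2) β) (hα : α ≪ μ) :
    ∃ T : E → E, Measurable T ∧ Brenier.IsOptimalTransport α β T ∧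
      (∀ S, Brenier.IsOptimalTransport α β S → S =ᵐ[α] T) ∧
      Brenier.IsConvexGradient α T ∧
      (∀ S, Brenier.IsTransport α β S → Brenier.IsConvexGradient α S → S =ᵐ[α] T) ∧
      (∀ S, Brenier.IsOptimalTransport α β S ↔
        Brenier.IsTransport α β S ∧ Brenier.IsConvexGradient α S) := by
  obtain ⟨T, hTm, hT, hTgrad⟩ := Brenier.exists_isTransport_isConvexGradient hα2 hβ2 hα
  have hopt (S : E → E) (hS : Brenier.IsTransport α β S) (hSgrad : Brenier.IsConvexGradient α S) :
      Brenier.IsOptimalTransport α β S := hSgrad.isOptimalTransport hS hα2 hβ2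
  have huniq (S : E → E) (hS : Brenier.IsOptimalTransport α β S) : S =ᵐ[α] T :=
    hTgrad.ae_eq_of_isOptimalTransport hT hS hα2 hβ2
  exact ⟨T, hTm, hopt T hT hTgrad, huniq, hTgrad, fun S hS hSgrad => huniq S (hopt S hS hSgrad),
    fun S => ⟨fun hS => ⟨hS.1, hTgrad.congr_ae (huniq S hS)⟩, fun hS => hopt S hS.1 hS.2⟩⟩

theorem mainTheorem1 (d : ℕ)
    (α β : Measure (EuclideanSpace ℝ (Fin d))) [IsProbabilityMeasure α] [IsProbabilityMeasure β]
    (hα2 : Integrable (fun x => ‖x‖ ^ 2) α) (hβ2 : Integrable (fun y => ‖y‖ ^ 2) β)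
    (hα : Brenier.HasLebesgueDensity α) :
    ∃ T : EuclideanSpace ℝ (Fin d) → EuclideanSpace ℝ (Fin d),
      -- existence and uniqueness of the optimal Monge map
      Measurable T ∧ Brenier.IsOptimalMongeMap α β T ∧
      (∀ S, Brenier.IsOptimalMongeMap α β S → S =ᵐ[α] T) ∧
      -- it is the unique gradient of a convex function that pushes `α` to `β`
      Brenier.IsGradientOfConvex α T ∧
      (∀ S, Brenier.IsTransportMap α β S → Brenier.IsGradientOfConvex α S → S =ᵐ[α] T) ∧
      -- and these two properties characterize optimality
      (∀ S, Brenier.IsOptimalMongeMap α β S ↔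
        Brenier.IsTransportMap α β S ∧ Brenier.IsGradientOfConvex α S) := by
  simp only [Brenier.isGradientOfConvex_iff_isConvexGradient]
  exact mainTheorem1_general hα2 hβ2 hα.absolutelyContinuous
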